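/- A \emph{skew brace} is a set $B$ with two group operations $\star$ and $\circ$ such that $a\circ(b\star c)=(a\circ b)\star a^{-1}\star(a\circ c)$ for all $a,b,c\in B$, where $a^{-1}$ is the inverse for $\star$; it is \emph{commutative} if $\circ$ is commutative. Morphisms are the maps that preserve both operations. (The operation $\circ$ binds more tightly than $\star$.) Let $X$ be an arbitrary set, let $M$ be the free commutative semigroup on $X$ (written with $\circ$; its elements are called monomials), and let $F$ be the free group on the set $M$, written with $\star$. For $m\in M$ let $\rho_m$ be the endomorphism of $F$ with $\rho_m(l)=(l\circ m)\star m^{-1}$ for $l\in M$, and put $u\circ m=\rho_m(u)\star m$ for $u\in F$. For $u\in F$ let $\lambda_u$ be the endomorphism of $F$ with $\lambda_u(m)=u^{-1}\star(u\circ m)$ for $m\in M$, and put $u\circ_l v=u\star\lambda_u(v)$ for $u,v\in F$. Let $N$ be the normal subgroup of $F$ generated by the elements $m^{-1}\star(m\circ l)\star l^{-1}$ with $m,l\in M$, and let $N'=[N,N]$. The operation $[u]\circ[v]=[u\circ_l v]$ is well defined on the group $F/N'$ and makes it a commutative monoid, whose neutral element is the neutral element $e$ of the group, and both brace distributivities $a\circ(b\star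 c)=a\circ b\star a^{-1}\star a\circ c$ and $(b\star c)\circ a=b\circ a\star a^{-1}\star c\circ a$ hold in $F/N'$. Let $B$ be the Grothendieck group of the monoid $(F/N',\circ)$, that is, the set of fractions $\frac{u}{v}$ with $u,v\in F/N'$, where $\frac{u}{v}=\frac{u_1}{v_1}$ if and only if $u\circ v_1\circ k=u_1\circ v\circ k$ for some $k\in F/N'$. \textbf{Theorem.} The monoid $(F/N',\circ)$ is cancellative, so that \[ \frac{u}{v}=\frac{u_1}{v_1}\iff u\circ v_1=v\circ u_1\qquad(u,v,u_1,v_1\in F/N'). \] With the well-defined operations \[ \frac{u}{v}\star\frac{u_1}{v_1}=\frac{u\circ v_1\star(v\circ v_1)^{-1}\star v\circ u_1}{v\circ v_1},\qquad \frac{u}{v}\circ\frac{u_1}{v_1}=\frac{u\circ u_1}{v\circ v_1}, \] $B$ is a commutative skew brace, and together with the map $\iota\colon X\to B$, $x\mapsto\frac{[x]}{e}$, it is the free commutative skew brace on $X$: for every commutative skew brace $C$ and every map $f\colon X\to C$ there is exactly one morphism of skew braces $\varphi\colon B\to C$ with $\varphi(\iota(x))=f(x)$ for all $x\in X$. -/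

import Mathlib

universe u v w

/-- A second binary operation `a ⊚ b` (the circle operation), next to a group operation which
is always written `a * b` and plays the role of `⋆`. The circle binds more tightly. -/
class HasCirc (W : Type u) where
  circ : W → W → W

infixl:75 " ⊚ " => HasCirc.circ

/-- A wire: a group `(W, *)` and a semigroup `(W, ⊚)` with both brace distributivities. -/
class Wire (W : Type u) extends Group W, HasCirc W where
  circ_assoc : ∀ a b c : W, a ⊚ b ⊚ c = a ⊚ (b ⊚ c)
  circ_mul : ∀ a b c : W, a ⊚ (b * c) = a ⊚ b * a⁻¹ * a ⊚ c
  mul_circ : ∀ a b c : W, (b * c) ⊚ a = b ⊚ a * a⁻¹ * c ⊚ a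

/-- A commutative wire: the circle operation is commutative. -/
class CommWire (W : Type u) extends Wire W where
  circ_comm : ∀ a b : W, a ⊚ b = b ⊚ a

/-- A skew brace: `(B, *)` and `(B, ⊚)` are groups, with left brace distributivity. -/
class SkewBrace (B : Type u) extends Group B, HasCirc B where
  circ_assoc : ∀ a b c : B, a ⊚ b ⊚ c = a ⊚ (b ⊚ c)
  circ_group : ∃ e : B, (∀ a : B, e ⊚ a = a ∧ a ⊚ e = a) ∧
    ∀ a : B, ∃ b : B, a ⊚ b = e ∧ b ⊚ a = e
  circ_mul : ∀ a b c : B, a ⊚ (b * c) = a ⊚ b * a⁻¹ * a ⊚ c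

/-- A commutative skew brace: the circle group is commutative. -/
class CommSkewBrace (B : Type u) extends SkewBrace B where
  circ_comm : ∀ a b : B, a ⊚ b = b ⊚ a

/-- Morphisms of skew braces: maps that preserve both operations. -/
structure IsSkewBraceHom {B : Type u} {C : Type v} [SkewBrace B] [SkewBrace C]
    (φ : B → C) : Prop where
  map_mul : ∀ a b : B, φ (a * b) = φ a * φ b
  map_circ : ∀ a b : B, φ (a ⊚ b) = φ a ⊚ φ b

/-- `B` together with `ι : X → B` is a free commutative skew brace on `X`, tested against the
commutative skew braces in an arbitrary universe `w`. -/
def IsFreeCommSkewBrace {X : Type u} {B : Type v} [CommSkewBrace B] (ι : X → B) : Prop :=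
  ∀ (C : Type w) [CommSkewBrace C] (f : X → C),
    ∃! φ : B → C, IsSkewBraceHom φ ∧ ∀ x : X, φ (ι x) = f x

/-! ### The free group on the free commutative semigroup -/

/-- The free commutative semigroup on `X`: nonempty finite multisets under union with
multiplicity, written multiplicatively. -/
def FreeCommSemigroup (X : Type u) : Type u := {s : Multiset X // s ≠ 0}

namespace FreeCommSemigroup

variable {X : Type u}

instance : CommSemigroup (FreeCommSemigroup X) where
  mul s t := ⟨s.1 + t.1, fun h => s.2 (add_eq_zero.1 h).1⟩
  mul_assoc s t r := Subtype.ext (add_assoc s.1 t.1 r.1)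
  mul_comm s t := Subtype.ext (add_comm s.1 t.1)

/-- The generator `x`. -/
def of (x : X) : FreeCommSemigroup X := ⟨{x}, Multiset.singleton_ne_zero x⟩

end FreeCommSemigroup

/-- The free group `F` on the set of monomials, i.e. on the free commutative semigroup. -/
abbrev PolyGroup (X : Type u) : Type u := FreeGroup (FreeCommSemigroup X)

namespace PolyGroup

variable {X : Type u}

/-- The generator of `F` given by a monomial. -/
abbrev mon (m : FreeCommSemigroup X) : PolyGroup X := FreeGroup.of m

/-- For a monomial `m`, the endomorphism `ρ_m` with `ρ_m(l) = (l ∘ m) ⋆ m⁻¹` on monomials. -/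
def rhoMon (m : FreeCommSemigroup X) : PolyGroup X →* PolyGroup X :=
  FreeGroup.lift fun l => mon (l * m) * (mon m)⁻¹

/-- `u ∘ m` for a word `u` and a monomial `m`. -/
def circMon (u : PolyGroup X) (m : FreeCommSemigroup X) : PolyGroup X :=
  rhoMon m u * mon m

/-- For a word `u`, the endomorphism `λ_u` with `λ_u(m) = u⁻¹ ⋆ (u ∘ m)` on monomials. -/
def lam (u : PolyGroup X) : PolyGroup X →* PolyGroup X :=
  FreeGroup.lift fun m => u⁻¹ * circMon u m

/-- The operation `u ∘_l v = u ⋆ λ_u(v)` on `F`. -/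
def circL (u v : PolyGroup X) : PolyGroup X := u * lam u v

/-- `N`: the normal subgroup generated by the elements `m⁻¹ ⋆ (m ∘ l) ⋆ l⁻¹`, for monomials
`m` and `l`. -/
def N (X : Type u) : Subgroup (PolyGroup X) :=
  Subgroup.normalClosure
    {w | ∃ m l : FreeCommSemigroup X, w = (mon m)⁻¹ * mon (m * l) * (mon l)⁻¹}

instance : (N X).Normal := Subgroup.normalClosure_normal

/-- `N' = [N, N]`. -/
abbrev N' (X : Type u) : Subgroup (PolyGroup X) := ⁅N X, N X⁆

theorem mk_mul_mon (m l : FreeCommSemigroup X) :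
    (QuotientGroup.mk (mon (m * l)) : PolyGroup X ⧸ N X) =
      QuotientGroup.mk (mon m) * QuotientGroup.mk (mon l) := by
  have h : (mon m)⁻¹ * mon (m * l) * (mon l)⁻¹ ∈ N X :=
    Subgroup.subset_normalClosure ⟨m, l, rfl⟩
  have h2 := (QuotientGroup.eq_one_iff _).2 h
  rw [QuotientGroup.mk_mul, QuotientGroup.mk_mul, QuotientGroup.mk_inv, QuotientGroup.mk_inv,
    mul_inv_eq_one, inv_mul_eq_iff_eq_mul] at h2
  exact h2

/-- An endomorphism of `F` that fixes the monomials modulo `N` is the identity modulo `N`. -/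
theorem mk_map_eq (φ : PolyGroup X →* PolyGroup X)
    (h : ∀ m, (QuotientGroup.mk (φ (mon m)) : PolyGroup X ⧸ N X) = QuotientGroup.mk (mon m))
    (x : PolyGroup X) : (QuotientGroup.mk (φ x) : PolyGroup X ⧸ N X) = QuotientGroup.mk x := by
  have : (QuotientGroup.mk' (N X)).comp φ = QuotientGroup.mk' (N X) :=
    FreeGroup.ext_hom _ _ h
  exact DFunLike.congr_fun this x

theorem map_N'_le (φ : PolyGroup X →* PolyGroup X)
    (h : ∀ m, (QuotientGroup.mk (φ (mon m)) : PolyGroup X ⧸ N X) = QuotientGroup.mk (mon m))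
    {x : PolyGroup X} (hx : x ∈ N' X) : φ x ∈ N' X := by
  have h1 : (N X).map φ ≤ N X := by
    rintro _ ⟨y, hy, rfl⟩
    rw [← QuotientGroup.eq_one_iff, mk_map_eq φ h, QuotientGroup.eq_one_iff]
    exact hy
  have h2 : (N' X).map φ ≤ N' X := by
    rw [Subgroup.map_commutator]
    exact Subgroup.commutator_mono h1 h1
  exact h2 ⟨x, hx, rfl⟩

theorem mk_map_congr (φ : PolyGroup X →* PolyGroup X)
    (h : ∀ m, (QuotientGroup.mk (φ (mon m)) : PolyGroup X ⧸ N X) = QuotientGroup.mk (mon m))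
    {x y : PolyGroup X} (hxy : (QuotientGroup.mk x : PolyGroup X ⧸ N' X) = QuotientGroup.mk y) :
    (QuotientGroup.mk (φ x) : PolyGroup X ⧸ N' X) = QuotientGroup.mk (φ y) := by
  rw [QuotientGroup.eq] at hxy ⊢
  rw [← map_inv, ← map_mul]
  exact map_N'_le φ h hxy

theorem rhoMon_mod (m l : FreeCommSemigroup X) :
    (QuotientGroup.mk (rhoMon m (mon l)) : PolyGroup X ⧸ N X) = QuotientGroup.mk (mon l) := by
  simp only [rhoMon, FreeGroup.lift_apply_of]
  rw [QuotientGroup.mk_mul, mk_mul_mon, QuotientGroup.mk_inv, mul_inv_cancel_right]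

theorem lam_mod (u : PolyGroup X) (m : FreeCommSemigroup X) :
    (QuotientGroup.mk (lam u (mon m)) : PolyGroup X ⧸ N X) = QuotientGroup.mk (mon m) := by
  simp only [lam, circMon, FreeGroup.lift_apply_of]
  rw [QuotientGroup.mk_mul, QuotientGroup.mk_mul, mk_map_eq _ (rhoMon_mod m),
    QuotientGroup.mk_inv, inv_mul_cancel_left]

theorem lam_congr {u u' : PolyGroup X}
    (h : (QuotientGroup.mk u : PolyGroup X ⧸ N' X) = QuotientGroup.mk u') (x : PolyGroup X) :
    (QuotientGroup.mk (lam u x) : PolyGroup X ⧸ N' X) = QuotientGroup.mk (lam u' x) := by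
  have : (QuotientGroup.mk' (N' X)).comp (lam u) = (QuotientGroup.mk' (N' X)).comp (lam u') := by
    refine FreeGroup.ext_hom _ _ fun m => ?_
    simp only [MonoidHom.comp_apply, QuotientGroup.mk'_apply, lam, circMon,
      FreeGroup.lift_apply_of, QuotientGroup.mk_mul, QuotientGroup.mk_inv, h,
      mk_map_congr _ (rhoMon_mod m) h]
  exact DFunLike.congr_fun this x

theorem circL_congr {u u' v v' : PolyGroup X}
    (hu : (QuotientGroup.mk u : PolyGroup X ⧸ N' X) = QuotientGroup.mk u')
    (hv : (QuotientGroup.mk v : PolyGroup X ⧸ N' X) = QuotientGroup.mk v') :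
    (QuotientGroup.mk (circL u v) : PolyGroup X ⧸ N' X) = QuotientGroup.mk (circL u' v') := by
  rw [circL, circL, QuotientGroup.mk_mul, QuotientGroup.mk_mul, hu, lam_congr hu,
    mk_map_congr _ (lam_mod u') hv]

end PolyGroup

/-! ### The commutative wire `F / N'` -/

/-- The quotient group `F / N'`. -/
def FreeCommWire (X : Type u) : Type u := PolyGroup X ⧸ PolyGroup.N' X

namespace FreeCommWire

open PolyGroup

variable {X : Type u}

instance : Group (FreeCommWire X) := inferInstanceAs (Group (PolyGroup X ⧸ PolyGroup.N' X))

/-- The canonical projection `F → F / N'`. -/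
def mk : PolyGroup X →* FreeCommWire X := QuotientGroup.mk' (PolyGroup.N' X)

/-- The class of the generator `x` in `F / N'`. -/
def of (x : X) : FreeCommWire X := mk (mon (FreeCommSemigroup.of x))

/-- The circle operation `[u] ∘ [v] = [u ∘_l v]` on `F / N'`. -/
instance : HasCirc (FreeCommWire X) where
  circ := Quotient.map₂ circL fun _ _ hu _ _ hv =>
    Quotient.exact (circL_congr (Quotient.sound hu) (Quotient.sound hv))

theorem mk_circ (u v : PolyGroup X) : mk u ⊚ mk v = mk (circL u v) := rfl

theorem mk_surjective : Function.Surjective (mk : PolyGroup X → FreeCommWire X) :=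
  QuotientGroup.mk'_surjective _

theorem circ_mul (a b c : FreeCommWire X) : a ⊚ (b * c) = a ⊚ b * a⁻¹ * a ⊚ c := by
  obtain ⟨u, rfl⟩ := mk_surjective a
  obtain ⟨v, rfl⟩ := mk_surjective b
  obtain ⟨w, rfl⟩ := mk_surjective c
  rw [← map_mul, mk_circ, mk_circ, mk_circ, ← map_inv, ← map_mul, ← map_mul]
  congr 1
  simp only [circL, map_mul]
  group

theorem mk_comm_of_mem {a b : PolyGroup X} (ha : a ∈ N X) (hb : b ∈ N X) :
    mk a * mk b = mk b * mk a := by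
  have h : mk (a * b * a⁻¹ * b⁻¹) = 1 :=
    (QuotientGroup.eq_one_iff _).2 (Subgroup.commutator_mem_commutator ha hb)
  rwa [map_mul, map_mul, map_mul, map_inv, map_inv, mul_inv_eq_one, mul_inv_eq_iff_eq_mul] at h

theorem conj_mod (v : PolyGroup X) (m : FreeCommSemigroup X) :
    (QuotientGroup.mk (v * mon m * v⁻¹) : PolyGroup X ⧸ N X) = QuotientGroup.mk (mon m) := by
  have h := mk_map_eq (MulAut.conj (mon m)).toMonoidHom (fun l => by
    change (QuotientGroup.mk (mon m * mon l * (mon m)⁻¹) : PolyGroup X ⧸ N X) = _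
    rw [QuotientGroup.mk_mul, QuotientGroup.mk_mul, QuotientGroup.mk_inv, ← mk_mul_mon,
      mul_comm m l, mk_mul_mon, mul_inv_cancel_right]) v
  change (QuotientGroup.mk (mon m * v * (mon m)⁻¹) : PolyGroup X ⧸ N X) = _ at h
  rw [QuotientGroup.mk_mul, QuotientGroup.mk_mul, QuotientGroup.mk_inv,
    mul_inv_eq_iff_eq_mul] at h
  rw [QuotientGroup.mk_mul, QuotientGroup.mk_mul, QuotientGroup.mk_inv, ← h,
    mul_inv_cancel_right]

theorem mk_lam_mul (u v x : PolyGroup X) :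
    mk (v * lam (u * v) x * v⁻¹) = mk (lam u x * x⁻¹ * (v * lam v x * v⁻¹)) := by
  have hv : ∀ y, (QuotientGroup.mk (v * lam v y * v⁻¹) : PolyGroup X ⧸ N X) =
      QuotientGroup.mk y := fun y => by
    have h := mk_map_eq (MulAut.conj v).toMonoidHom (conj_mod v) (lam v y)
    exact h.trans (mk_map_eq _ (lam_mod v) y)
  have hu : ∀ y, (QuotientGroup.mk (lam u y) : PolyGroup X ⧸ N X) = QuotientGroup.mk y :=
    mk_map_eq _ (lam_mod u)
  let ψ : PolyGroup X →* FreeCommWire X :=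
    MonoidHom.mk' (fun y => mk (lam u y * y⁻¹ * (v * lam v y * v⁻¹))) (by
      intro y z
      have h1 : lam u z * z⁻¹ ∈ N X := by
        rw [← QuotientGroup.eq_one_iff, QuotientGroup.mk_mul, hu, QuotientGroup.mk_inv,
          mul_inv_cancel]
      have h2 : y⁻¹ * (v * lam v y * v⁻¹) ∈ N X := by
        rw [← QuotientGroup.eq_one_iff, QuotientGroup.mk_mul, hv, QuotientGroup.mk_inv,
          inv_mul_cancel]
      have h3 := mk_comm_of_mem h1 h2
      calc mk (lam u (y * z) * (y * z)⁻¹ * (v * lam v (y * z) * v⁻¹))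
          = mk (lam u y) * (mk (lam u z * z⁻¹) * mk (y⁻¹ * (v * lam v y * v⁻¹))) *
              mk (v * lam v z * v⁻¹) := by
            rw [← map_mul, ← map_mul, ← map_mul]
            congr 1
            rw [map_mul, map_mul]
            group
        _ = mk (lam u y * y⁻¹ * (v * lam v y * v⁻¹)) *
              mk (lam u z * z⁻¹ * (v * lam v z * v⁻¹)) := by
            rw [h3, ← map_mul, ← map_mul, ← map_mul, ← map_mul]
            congr 1
            group)
  let φ : PolyGroup X →* FreeCommWire X :=
    mk.comp ((MulAut.conj v).toMonoidHom.comp (lam (u * v)))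
  have h : φ = ψ := by
    refine FreeGroup.ext_hom _ _ fun m => ?_
    change mk (v * lam (u * v) (mon m) * v⁻¹) =
      mk (lam u (mon m) * (mon m)⁻¹ * (v * lam v (mon m) * v⁻¹))
    congr 1
    simp only [lam, circMon, FreeGroup.lift_apply_of, map_mul]
    group
  exact DFunLike.congr_fun h x

theorem mul_circ (a b c : FreeCommWire X) : (b * c) ⊚ a = b ⊚ a * a⁻¹ * c ⊚ a := by
  obtain ⟨x, rfl⟩ := mk_surjective a
  obtain ⟨u, rfl⟩ := mk_surjective b
  obtain ⟨v, rfl⟩ := mk_surjective c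
  have h := mk_lam_mul u v x
  rw [← map_mul, mk_circ, mk_circ, mk_circ, ← map_inv, ← map_mul, ← map_mul]
  simp only [circL, map_mul, map_inv] at h ⊢
  rw [mul_inv_eq_iff_eq_mul] at h
  rw [mul_assoc, h]
  group

theorem circ_one (a : FreeCommWire X) : a ⊚ 1 = a := by
  have h := circ_mul a 1 1
  rw [mul_one, mul_assoc, left_eq_mul, inv_mul_eq_one] at h
  exact h.symm

theorem one_circ (a : FreeCommWire X) : 1 ⊚ a = a := by
  have h := mul_circ a 1 1
  rw [mul_one, mul_assoc, left_eq_mul, inv_mul_eq_one] at h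
  exact h.symm

theorem circ_inv (a b : FreeCommWire X) : a ⊚ b⁻¹ = a * (a ⊚ b)⁻¹ * a := by
  have h := circ_mul a b⁻¹ b
  rw [inv_mul_cancel, circ_one] at h
  exact mul_inv_eq_iff_eq_mul.1 (eq_mul_inv_of_mul_eq h.symm)

theorem inv_circ (a b : FreeCommWire X) : b⁻¹ ⊚ a = a * (b ⊚ a)⁻¹ * a := by
  have h := mul_circ a b⁻¹ b
  rw [inv_mul_cancel, one_circ] at h
  exact mul_inv_eq_iff_eq_mul.1 (eq_mul_inv_of_mul_eq h.symm)

/-- Elements of `F / N'` are generated from the monomials by `*` and inverses. -/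
theorem induction_mon {p : FreeCommWire X → Prop} (h1 : p 1) (hm : ∀ m, p (mk (mon m)))
    (hi : ∀ a, p a → p a⁻¹) (hmul : ∀ a b, p a → p b → p (a * b)) (a : FreeCommWire X) :
    p a := by
  obtain ⟨u, rfl⟩ := mk_surjective a
  induction u using FreeGroup.induction_on with
  | C1 => rw [map_one]; exact h1
  | of m => exact hm m
  | inv_of m h => rw [map_inv]; exact hi _ h
  | mul x y hx hy => rw [map_mul]; exact hmul _ _ hx hy

theorem mon_circ_mon (m l : FreeCommSemigroup X) :
    mk (mon m) ⊚ mk (mon l) = mk (mon (m * l)) := by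
  rw [mk_circ]
  simp [circL, lam, circMon, rhoMon]

theorem circ_comm (a b : FreeCommWire X) : a ⊚ b = b ⊚ a := by
  induction a using induction_mon with
  | h1 => rw [circ_one, one_circ]
  | hi a h => rw [inv_circ, circ_inv, h]
  | hmul a c ha hc => rw [mul_circ, circ_mul, ha, hc]
  | hm m =>
    induction b using induction_mon with
    | h1 => rw [circ_one, one_circ]
    | hi a h => rw [inv_circ, circ_inv, h]
    | hmul a c ha hc => rw [mul_circ, circ_mul, ha, hc]
    | hm l => rw [mon_circ_mon, mon_circ_mon, mul_comm]

theorem circ_assoc (a b c : FreeCommWire X) : a ⊚ b ⊚ c = a ⊚ (b ⊚ c) := by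
  induction a using induction_mon with
  | h1 => rw [one_circ, one_circ]
  | hi a h => simp only [inv_circ, mul_circ, h]; group
  | hmul a d ha hd => simp only [mul_circ, ha, hd, inv_circ]; group
  | hm m =>
    induction b using induction_mon with
    | h1 => rw [circ_one, one_circ]
    | hi a h => simp only [inv_circ, circ_inv, mul_circ, circ_mul, h]; group
    | hmul a d ha hd => simp only [mul_circ, circ_mul, ha, hd, inv_circ, circ_inv]; group
    | hm l =>
      induction c using induction_mon with
      | h1 => rw [circ_one, circ_one]
      | hi a h => simp only [circ_inv, circ_mul, h]; group
      | hmul a d ha hd => simp only [circ_mul, ha, hd, circ_inv]; group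
      | hm k => rw [mon_circ_mon, mon_circ_mon, mon_circ_mon, mon_circ_mon, mul_assoc]

instance : CommWire (FreeCommWire X) where
  circ_assoc := circ_assoc
  circ_mul := circ_mul
  mul_circ := mul_circ
  circ_comm := circ_comm

end FreeCommWire

/-! ### The skew brace of fractions of a commutative wire -/

namespace CommWire

variable {W : Type u} [CommWire W]

instance : Std.Associative (HasCirc.circ : W → W → W) := ⟨Wire.circ_assoc⟩

instance : Std.Commutative (HasCirc.circ : W → W → W) := ⟨CommWire.circ_comm⟩

theorem circ_one (a : W) : a ⊚ 1 = a := by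
  have h := Wire.circ_mul a 1 1
  rw [mul_one, mul_assoc, left_eq_mul, inv_mul_eq_one] at h
  exact h.symm

theorem one_circ (a : W) : 1 ⊚ a = a := by
  rw [circ_comm, circ_one]

theorem circ_inv (a b : W) : a ⊚ b⁻¹ = a * (a ⊚ b)⁻¹ * a := by
  have h := Wire.circ_mul a b⁻¹ b
  rw [inv_mul_cancel, circ_one] at h
  exact mul_inv_eq_iff_eq_mul.1 (eq_mul_inv_of_mul_eq h.symm)

theorem circ_truss (x a b c : W) : x ⊚ (a * b⁻¹ * c) = x ⊚ a * (x ⊚ b)⁻¹ * x ⊚ c := by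
  rw [Wire.circ_mul, Wire.circ_mul, circ_inv]
  group

theorem truss_circ (x a b c : W) : (a * b⁻¹ * c) ⊚ x = a ⊚ x * (b ⊚ x)⁻¹ * c ⊚ x := by
  rw [circ_comm, circ_truss, circ_comm x, circ_comm x, circ_comm x]

theorem circ_left_comm (a b c : W) : a ⊚ (b ⊚ c) = b ⊚ (a ⊚ c) := by ac_rfl

/-- `(u, v) ∼ (u₁, v₁)` iff `u ∘ v₁ ∘ k = u₁ ∘ v ∘ k` for some `k`: the equivalence relation
that defines the Grothendieck group of the commutative monoid `(W, ∘)`. -/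
def fracSetoid (W : Type u) [CommWire W] : Setoid (W × W) where
  r p q := ∃ k : W, p.1 ⊚ q.2 ⊚ k = q.1 ⊚ p.2 ⊚ k
  iseqv :=
    { refl := fun _ => ⟨1, rfl⟩
      symm := fun ⟨k, h⟩ => ⟨k, h.symm⟩
      trans := by
        rintro ⟨u, v⟩ ⟨x, y⟩ ⟨z, t⟩ ⟨k, h⟩ ⟨l, h'⟩
        refine ⟨y ⊚ k ⊚ l, ?_⟩
        dsimp only at h h' ⊢
        calc u ⊚ t ⊚ (y ⊚ k ⊚ l) = (u ⊚ y ⊚ k) ⊚ (t ⊚ l) := by ac_rfl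
          _ = (x ⊚ v ⊚ k) ⊚ (t ⊚ l) := by rw [h]
          _ = (x ⊚ t ⊚ l) ⊚ (v ⊚ k) := by ac_rfl
          _ = (z ⊚ y ⊚ l) ⊚ (v ⊚ k) := by rw [h']
          _ = z ⊚ v ⊚ (y ⊚ k ⊚ l) := by ac_rfl }

end CommWire

open CommWire in
/-- The set of fractions `u / v` with `u, v ∈ W`. -/
def Fractions (W : Type u) [CommWire W] : Type u := Quotient (fracSetoid W)

namespace Fractions

open CommWire

variable {W : Type u} [CommWire W]

/-- The fraction `u / v`. -/
def frac (u v : W) : Fractions W := Quotient.mk (fracSetoid W) (u, v)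

theorem frac_eq {u v x y : W} (k : W) (h : u ⊚ y ⊚ k = x ⊚ v ⊚ k) : frac u v = frac x y :=
  Quotient.sound (s := fracSetoid W) ⟨k, h⟩

theorem exists_frac (a : Fractions W) : ∃ u v : W, a = frac u v := by
  induction a using Quotient.inductionOn with
  | h p => exact ⟨p.1, p.2, rfl⟩

/-- `u / v ∘ u₁ / v₁ = (u ∘ u₁) / (v ∘ v₁)`. -/
instance : HasCirc (Fractions W) where
  circ := Quotient.map₂ (fun p q => (p.1 ⊚ q.1, p.2 ⊚ q.2)) <| by
    rintro ⟨u, v⟩ ⟨x, y⟩ ⟨k, h⟩ ⟨u₁, v₁⟩ ⟨x₁, y₁⟩ ⟨k₁, h₁⟩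
    refine ⟨k ⊚ k₁, ?_⟩
    dsimp only at h h₁ ⊢
    calc u ⊚ u₁ ⊚ (y ⊚ y₁) ⊚ (k ⊚ k₁) = (u ⊚ y ⊚ k) ⊚ (u₁ ⊚ y₁ ⊚ k₁) := by ac_rfl
      _ = (x ⊚ v ⊚ k) ⊚ (x₁ ⊚ v₁ ⊚ k₁) := by rw [h, h₁]
      _ = x ⊚ x₁ ⊚ (v ⊚ v₁) ⊚ (k ⊚ k₁) := by ac_rfl

/-- `u / v ⋆ u₁ / v₁ = ((u ∘ v₁) ⋆ (v ∘ v₁)⁻¹ ⋆ (u₁ ∘ v)) / (v ∘ v₁)`. -/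
instance : Mul (Fractions W) where
  mul := Quotient.map₂
    (fun p q => (p.1 ⊚ q.2 * (p.2 ⊚ q.2)⁻¹ * q.1 ⊚ p.2, p.2 ⊚ q.2)) <| by
    rintro ⟨u, v⟩ ⟨x, y⟩ ⟨k, h⟩ ⟨u₁, v₁⟩ ⟨x₁, y₁⟩ ⟨k₁, h₁⟩
    refine ⟨k ⊚ k₁, ?_⟩
    dsimp only at h h₁ ⊢
    have e₁ : y ⊚ y₁ ⊚ (k ⊚ k₁) ⊚ (u ⊚ v₁) = v ⊚ v₁ ⊚ (k ⊚ k₁) ⊚ (x ⊚ y₁) := by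
      calc _ = (u ⊚ y ⊚ k) ⊚ (v₁ ⊚ y₁ ⊚ k₁) := by ac_rfl
        _ = (x ⊚ v ⊚ k) ⊚ (v₁ ⊚ y₁ ⊚ k₁) := by rw [h]
        _ = _ := by ac_rfl
    have e₂ : y ⊚ y₁ ⊚ (k ⊚ k₁) ⊚ (v ⊚ v₁) = v ⊚ v₁ ⊚ (k ⊚ k₁) ⊚ (y ⊚ y₁) := by ac_rfl
    have e₃ : y ⊚ y₁ ⊚ (k ⊚ k₁) ⊚ (u₁ ⊚ v) = v ⊚ v₁ ⊚ (k ⊚ k₁) ⊚ (x₁ ⊚ y) := by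
      calc _ = (u₁ ⊚ y₁ ⊚ k₁) ⊚ (v ⊚ y ⊚ k) := by ac_rfl
        _ = (x₁ ⊚ v₁ ⊚ k₁) ⊚ (v ⊚ y ⊚ k) := by rw [h₁]
        _ = _ := by ac_rfl
    calc _ = y ⊚ y₁ ⊚ (k ⊚ k₁) ⊚ (u ⊚ v₁ * (v ⊚ v₁)⁻¹ * u₁ ⊚ v) := by ac_rfl
      _ = v ⊚ v₁ ⊚ (k ⊚ k₁) ⊚ (x ⊚ y₁ * (y ⊚ y₁)⁻¹ * x₁ ⊚ y) := by
        rw [circ_truss, circ_truss, e₁, e₂, e₃]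
      _ = _ := by ac_rfl

/-- The neutral element `e / e`. -/
instance : One (Fractions W) := ⟨frac 1 1⟩

/-- The inverse of `u / v` for `⋆` is `(v ⋆ u⁻¹ ⋆ v) / v`. -/
instance : Inv (Fractions W) where
  inv := Quotient.map (fun p => (p.2 * p.1⁻¹ * p.2, p.2)) <| by
    rintro ⟨u, v⟩ ⟨x, y⟩ ⟨k, h⟩
    refine ⟨k, ?_⟩
    dsimp only at h ⊢
    have e₁ : y ⊚ k ⊚ u = v ⊚ k ⊚ x := by
      calc _ = u ⊚ y ⊚ k := by ac_rfl
        _ = x ⊚ v ⊚ k := h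
        _ = _ := by ac_rfl
    have e₂ : y ⊚ k ⊚ v = v ⊚ k ⊚ y := by ac_rfl
    calc _ = y ⊚ k ⊚ (v * u⁻¹ * v) := by ac_rfl
      _ = v ⊚ k ⊚ (y * x⁻¹ * y) := by rw [circ_truss, circ_truss, e₁, e₂]
      _ = _ := by ac_rfl

theorem frac_circ (u v x y : W) : frac u v ⊚ frac x y = frac (u ⊚ x) (v ⊚ y) := rfl

theorem frac_mul (u v x y : W) :
    frac u v * frac x y = frac (u ⊚ y * (v ⊚ y)⁻¹ * x ⊚ v) (v ⊚ y) := rfl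

theorem frac_inv (u v : W) : (frac u v)⁻¹ = frac (v * u⁻¹ * v) v := rfl

theorem one_def : (1 : Fractions W) = frac 1 1 := rfl

instance : Group (Fractions W) :=
  Group.ofLeftAxioms
    (by
      intro a b c
      obtain ⟨u, v, rfl⟩ := exists_frac a
      obtain ⟨x, y, rfl⟩ := exists_frac b
      obtain ⟨z, t, rfl⟩ := exists_frac c
      rw [frac_mul, frac_mul, frac_mul, frac_mul, truss_circ, truss_circ]
      simp only [circ_comm, circ_left_comm, mul_assoc])
    (by
      intro a
      obtain ⟨u, v, rfl⟩ := exists_frac a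
      rw [one_def, frac_mul, one_circ, circ_one, mul_inv_cancel, one_mul])
    (by
      intro a
      obtain ⟨u, v, rfl⟩ := exists_frac a
      rw [frac_inv, frac_mul, truss_circ, mul_inv_cancel_right, inv_mul_cancel_right, one_def]
      exact frac_eq 1 (by ac_rfl))

/-- The skew brace of fractions of a commutative wire. -/
instance : CommSkewBrace (Fractions W) where
  circ_assoc a b c := by
    obtain ⟨u, v, rfl⟩ := exists_frac a
    obtain ⟨x, y, rfl⟩ := exists_frac b
    obtain ⟨z, t, rfl⟩ := exists_frac c
    simp only [frac_circ, Wire.circ_assoc]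
  circ_comm a b := by
    obtain ⟨u, v, rfl⟩ := exists_frac a
    obtain ⟨x, y, rfl⟩ := exists_frac b
    rw [frac_circ, frac_circ, circ_comm u, circ_comm v]
  circ_group := by
    refine ⟨1, fun a => ?_, fun a => ?_⟩
    · obtain ⟨u, v, rfl⟩ := exists_frac a
      rw [one_def, frac_circ, frac_circ, one_circ, one_circ, circ_one, circ_one]
      exact ⟨rfl, rfl⟩
    · obtain ⟨u, v, rfl⟩ := exists_frac a
      refine ⟨frac v u, ?_, ?_⟩ <;> rw [one_def, frac_circ] <;>
        exact frac_eq 1 (by ac_rfl)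
  circ_mul a b c := by
    obtain ⟨u, v, rfl⟩ := exists_frac a
    obtain ⟨x, y, rfl⟩ := exists_frac b
    obtain ⟨z, t, rfl⟩ := exists_frac c
    rw [frac_inv, frac_circ, frac_circ, frac_mul, frac_circ, frac_mul, frac_mul]
    refine frac_eq 1 ?_
    simp only [circ_one, truss_circ, circ_truss]
    simp only [circ_comm, circ_left_comm]
    group

end Fractions

/-! ### Commutative skew braces as commutative wires -/

namespace CommSkewBrace

variable {C : Type w} [CommSkewBrace C]

/-! The universal property and cancellativity have separate proofs. In a commutative wire the
defects `a⁻¹ * a ⊚ b * b⁻¹` commute with each other and generate a normal subgroup, which is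
therefore abelian. Evaluating words of `F` in a commutative skew brace sends `N` into this subgroup,
hence kills `N'`, and so factors through `F / N'`. The induced map respects `⊚` by distributivity in
each argument, and extends to fractions because circle inverses exist in the target. A morphism is
determined by its values on `X`: these fix it on monomials through `⊚`, then on `F / N'` through
`*`, then on fractions. Cancellativity comes from a Magnus embedding. A monomial with exponent `a`
in the free abelian group and polynomial counterpart `t` acts on `MagnusRing X` by `y ↦ a (y - 1) +
t`. The subgroup `N` acts by translations, so `N'` acts trivially, and the orbit map of `1` gives
`magnus : F / N' → MagnusRing X`. This map turns `⊚` into ring multiplication (`magnus_circ`). It is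
injective (`magnus_injective`), since the class of an element of `N` in the abelianization of `N`
can be read off from its translation (`pathHom_affine`). It never vanishes, since substituting group
generators for the polynomial variables turns its values into group elements (`specialize_magnus`).
As the Magnus ring has no zero divisors, `⊚` is cancellative. -/

instance toCommWire : CommWire C where
  circ_assoc := SkewBrace.circ_assoc
  circ_mul := SkewBrace.circ_mul
  mul_circ a b c := by
    rw [circ_comm (b * c), circ_comm b, circ_comm c, SkewBrace.circ_mul]
  circ_comm := circ_comm

/-- The two groups share their neutral element: if `e` is neutral for `⊚`, then `e = e ⊚ 1 = 1`. -/
theorem exists_circ_eq_one (a : C) : ∃ b : C, a ⊚ b = 1 := by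
  obtain ⟨e, he, hinv⟩ := SkewBrace.circ_group (B := C)
  obtain ⟨b, hb, -⟩ := hinv a
  refine ⟨b, hb.trans ?_⟩
  rw [← (he 1).1, CommWire.circ_one]

/-- The inverse for the circle operation. -/
noncomputable def circInv (a : C) : C := (exists_circ_eq_one a).choose

theorem circ_circInv (a : C) : a ⊚ circInv a = 1 := (exists_circ_eq_one a).choose_spec

theorem circ_right_cancel {a b c : C} (h : a ⊚ c = b ⊚ c) : a = b := by
  rw [← CommWire.circ_one a, ← CommWire.circ_one b, ← circ_circInv c, ← Wire.circ_assoc, h,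
    Wire.circ_assoc]

theorem eq_circ_circInv_iff {a b c : C} : a = b ⊚ circInv c ↔ a ⊚ c = b := by
  have h : b ⊚ circInv c ⊚ c = b := by
    rw [Wire.circ_assoc, CommWire.circ_comm _ c, circ_circInv, CommWire.circ_one]
  refine ⟨fun e => e ▸ h, fun e => circ_right_cancel (c := c) (e.trans h.symm)⟩

end CommSkewBrace

/-! ### The defect subgroup of a commutative wire -/

namespace CommWire

variable {W : Type u} [CommWire W]

/-- The element `a⁻¹ ⋆ (a ∘ b) ⋆ b⁻¹`, which measures by how much the two operations differ. -/
def defect (a b : W) : W := a⁻¹ * a ⊚ b * b⁻¹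

/-- Expanding `(c * b) ⊚ (a * d)` first on the right or first on the left gives two words with the
same first factor `c ⊚ a` and the same last factor `b ⊚ d`; what remains between them is the claim.
-/
theorem defect_mul_comm (a b c d : W) :
    defect a b * defect c d = defect c d * defect a b := by
  have h₁ : (c * b) ⊚ (a * d) = c ⊚ a * a⁻¹ * (b ⊚ a) * (b⁻¹ * c⁻¹) *
      (c ⊚ d * d⁻¹ * b ⊚ d) := by
    rw [Wire.circ_mul, Wire.mul_circ, Wire.mul_circ, mul_inv_rev]
  have h₂ : (c * b) ⊚ (a * d) = c ⊚ a * c⁻¹ * c ⊚ d * (d⁻¹ * a⁻¹) *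
      (b ⊚ a * b⁻¹ * b ⊚ d) := by
    rw [Wire.mul_circ, Wire.circ_mul, Wire.circ_mul, mul_inv_rev]
  rw [h₁] at h₂
  rw [defect, defect, circ_comm a b]
  have h₃ := congrArg (fun x => (c ⊚ a)⁻¹ * x * (b ⊚ d)⁻¹) h₂
  simpa only [mul_assoc, inv_mul_cancel_left, mul_inv_cancel, mul_one] using h₃

/-- Left distributivity for `a ⊚ (b * c)`, rearranged. It makes the subgroup generated by the
defects normal. -/
theorem conj_defect (a b c : W) : b * defect a c * b⁻¹ = (defect a b)⁻¹ * defect a (b * c) := by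
  rw [defect, defect, defect, Wire.circ_mul]
  group

/-- The subgroup generated by all the defects. -/
def defectSubgroup (W : Type u) [CommWire W] : Subgroup W :=
  Subgroup.closure {x | ∃ a b : W, x = defect a b}

theorem defect_mem (a b : W) : defect a b ∈ defectSubgroup W :=
  Subgroup.subset_closure ⟨a, b, rfl⟩

instance : (defectSubgroup W).Normal where
  conj_mem x hx g := by
    have h : defectSubgroup W ≤ (defectSubgroup W).comap (MulAut.conj g).toMonoidHom := by
      refine (Subgroup.closure_le _).2 ?_
      rintro _ ⟨a, b, rfl⟩
      change g * defect a b * g⁻¹ ∈ defectSubgroup W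
      rw [conj_defect]
      exact mul_mem (inv_mem (defect_mem _ _)) (defect_mem _ _)
    exact h hx

theorem commutator_defectSubgroup : ⁅defectSubgroup W, defectSubgroup W⁆ = ⊥ := by
  rw [Subgroup.commutator_eq_bot_iff_le_centralizer, defectSubgroup, Subgroup.centralizer_closure,
    Subgroup.closure_le]
  rintro _ ⟨a, b, rfl⟩
  rintro _ ⟨c, d, rfl⟩
  exact defect_mul_comm _ _ _ _

end CommWire

theorem FreeCommSemigroup.induction_on {X : Type u} {p : FreeCommSemigroup X → Prop}
    (of : ∀ x, p (of x)) (of_mul : ∀ x m, p m → p (FreeCommSemigroup.of x * m))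
    (m : FreeCommSemigroup X) : p m := by
  obtain ⟨s, hs⟩ := m
  induction s using Multiset.induction_on with
  | empty => exact absurd rfl hs
  | cons x s ih =>
    by_cases h : s = 0
    · subst h
      exact of x
    · exact of_mul x ⟨s, h⟩ (ih h)

/-! ### Maps out of the commutative wire `F / N'` -/

namespace FreeCommWire

open PolyGroup

variable {X : Type u}

/-- Descent of a group homomorphism along `F → F / N'`. -/
def lift {G : Type v} [Group G] (φ : PolyGroup X →* G) (h : N' X ≤ φ.ker) : FreeCommWire X →* G :=
  QuotientGroup.lift (N' X) φ h

@[simp]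
theorem lift_mk {G : Type v} [Group G] (φ : PolyGroup X →* G) (h : N' X ≤ φ.ker)
    (w : PolyGroup X) : lift φ h (mk w) = φ w := rfl

section CommSkewBrace

variable {C : Type w} [CommSkewBrace C] (f : X → C)

/-- The value of a monomial under the substitution `f`. -/
def evalMon (m : FreeCommSemigroup X) : C := Multiset.fold (· ⊚ ·) 1 (m.1.map f)

theorem evalMon_mul (m l : FreeCommSemigroup X) :
    evalMon f (m * l) = evalMon f m ⊚ evalMon f l := by
  change Multiset.fold _ 1 ((m.1 + l.1).map f) = _
  rw [Multiset.map_add]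
  -- Folding over a sum of multisets needs an initial value for each summand, so `1` is split as `1
  -- ⊚ 1`.
  conv_lhs => rw [← CommWire.circ_one (1 : C)]
  exact Multiset.fold_add _ _ _ _ _

theorem evalMon_of (x : X) : evalMon f (FreeCommSemigroup.of x) = f x :=
  CommWire.circ_one (f x)

/-- The value of a word under the substitution `f`. -/
def evalWord : PolyGroup X →* C := FreeGroup.lift (evalMon f)

/-- The generators of `N` evaluate to defects, and the defect subgroup is normal and abelian. -/
theorem commutator_N_le_ker_evalWord : N' X ≤ (evalWord f).ker := by
  have h : N X ≤ (CommWire.defectSubgroup C).comap (evalWord f) := by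
    refine Subgroup.normalClosure_le_normal ?_
    rintro _ ⟨m, l, rfl⟩
    have : evalWord f ((mon m)⁻¹ * mon (m * l) * (mon l)⁻¹) =
        CommWire.defect (evalMon f m) (evalMon f l) := by
      simp [evalWord, CommWire.defect, evalMon_mul]
    exact Subgroup.mem_comap.2 (this ▸ CommWire.defect_mem _ _)
  rw [← MonoidHom.comap_bot, ← CommWire.commutator_defectSubgroup, ← Subgroup.map_le_iff_le_comap,
    Subgroup.map_commutator]
  exact Subgroup.commutator_mono (Subgroup.map_le_iff_le_comap.2 h)
    (Subgroup.map_le_iff_le_comap.2 h)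

/-- The homomorphism from `F / N'` to a commutative skew brace given by the substitution `f`. -/
def eval : FreeCommWire X →* C := lift (evalWord f) (commutator_N_le_ker_evalWord f)

theorem eval_mon (m : FreeCommSemigroup X) : eval f (mk (mon m)) = evalMon f m := by
  simp [eval, evalWord]

theorem eval_of (x : X) : eval f (of x) = f x := by
  rw [of, eval_mon, evalMon_of]

theorem eval_circ (a b : FreeCommWire X) : eval f (a ⊚ b) = eval f a ⊚ eval f b := by
  induction a using induction_mon with
  | h1 => rw [one_circ, map_one, CommWire.one_circ]
  | hi a h =>
    rw [inv_circ, map_mul, map_mul, map_inv, map_inv, h, CommWire.circ_comm _⁻¹,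
      CommWire.circ_inv, CommWire.circ_comm (eval f b)]
  | hmul a c ha hc => rw [mul_circ, map_mul, map_mul, map_inv, ha, hc, map_mul, Wire.mul_circ]
  | hm m =>
    induction b using induction_mon with
    | h1 => rw [circ_one, map_one, CommWire.circ_one]
    | hi a h => rw [circ_inv, map_mul, map_mul, map_inv, map_inv, h, CommWire.circ_inv]
    | hmul a c ha hc =>
      rw [circ_mul, map_mul, map_mul, map_inv, ha, hc, map_mul, Wire.circ_mul]
    | hm l => rw [mon_circ_mon, eval_mon, eval_mon, eval_mon, evalMon_mul]

end CommSkewBrace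

end FreeCommWire

/-! ### Extension of homomorphisms to fractions -/

namespace Fractions

open CommWire CommSkewBrace

theorem frac_mul_one {W : Type u} [CommWire W] (a b : W) :
    frac (a * b) 1 = frac a 1 * frac b 1 := by
  rw [frac_mul, circ_one, circ_one, circ_one, inv_one, mul_one]

theorem frac_circ_one {W : Type u} [CommWire W] (a b : W) :
    frac (a ⊚ b) 1 = frac a 1 ⊚ frac b 1 := by
  rw [frac_circ, circ_one]

/-- Clearing the denominator: a circle-preserving map into a skew brace is determined on fractions
by its values on those with denominator `1`. -/
theorem frac_circ_denom {W : Type u} [CommWire W] (a b : W) :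
    frac a b ⊚ frac b 1 = frac a 1 := by
  rw [frac_circ]
  exact frac_eq 1 (by simp only [circ_one])

/-- A homomorphism from a commutative wire to a commutative skew brace extends to the
fractions. -/
noncomputable def lift {W : Type u} {C : Type w} [CommWire W] [CommSkewBrace C] (φ : W →* C)
    (hφ : ∀ a b, φ (a ⊚ b) = φ a ⊚ φ b) : Fractions W → C :=
  Quotient.lift (fun p => φ p.1 ⊚ circInv (φ p.2)) <| by
    rintro ⟨a, b⟩ ⟨c, d⟩ ⟨k, h⟩
    have h' := congrArg φ h
    simp only [hφ] at h'
    replace h' := circ_right_cancel h'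
    dsimp only
    rw [eq_circ_circInv_iff]
    symm
    calc φ c = φ c ⊚ φ b ⊚ circInv (φ b) := by rw [Wire.circ_assoc, circ_circInv, circ_one]
      _ = φ a ⊚ φ d ⊚ circInv (φ b) := by rw [h']
      _ = φ a ⊚ circInv (φ b) ⊚ φ d := by ac_rfl

section Lift

variable {W : Type u} {C : Type w} [CommWire W] [CommSkewBrace C] (φ : W →* C)
    (hφ : ∀ a b, φ (a ⊚ b) = φ a ⊚ φ b)

theorem lift_frac (a b : W) : lift φ hφ (frac a b) = φ a ⊚ circInv (φ b) := rfl

theorem lift_frac_circ (a b : W) : lift φ hφ (frac a b) ⊚ φ b = φ a :=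
  eq_circ_circInv_iff.1 (lift_frac φ hφ a b)

theorem isSkewBraceHom_lift : IsSkewBraceHom (lift φ hφ) where
  map_circ p q := by
    obtain ⟨a, b, rfl⟩ := exists_frac p
    obtain ⟨c, d, rfl⟩ := exists_frac q
    rw [frac_circ, eq_comm, lift_frac _ _ (a ⊚ c), eq_circ_circInv_iff, hφ, hφ]
    calc _ = (lift φ hφ (frac a b) ⊚ φ b) ⊚ (lift φ hφ (frac c d) ⊚ φ d) := by ac_rfl
      _ = _ := by rw [lift_frac_circ, lift_frac_circ]
  map_mul p q := by
    obtain ⟨a, b, rfl⟩ := exists_frac p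
    obtain ⟨c, d, rfl⟩ := exists_frac q
    -- Both sides are multiplied by the common denominator `φ b ⊚ φ d`; right distributivity then
    -- produces the numerator of the sum of fractions.
    rw [frac_mul, eq_comm, lift_frac _ _ (_ * _), eq_circ_circInv_iff, map_mul, map_mul, map_inv,
      hφ, hφ, hφ, Wire.mul_circ, ← lift_frac_circ φ hφ a b, ← lift_frac_circ φ hφ c d]
    congr 1
    · congr 1
      ac_rfl
    · ac_rfl

end Lift

end Fractions

/-! ### Uniqueness and the universal property -/

namespace FreeCommWire

open PolyGroup CommWire

variable {X : Type u} {C : Type w} [CommSkewBrace C]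

theorem hom_mon_unique {φ ψ : FreeCommWire X → C} (hφ : ∀ a b, φ (a ⊚ b) = φ a ⊚ φ b)
    (hψ : ∀ a b, ψ (a ⊚ b) = ψ a ⊚ ψ b) (h : ∀ x, φ (of x) = ψ (of x))
    (m : FreeCommSemigroup X) : φ (mk (mon m)) = ψ (mk (mon m)) := by
  induction m using FreeCommSemigroup.induction_on with
  | of x => exact h x
  | of_mul x m ih =>
    rw [← mon_circ_mon, hφ, hψ, ih]
    exact congrArg (· ⊚ _) (h x)

theorem hom_unique {φ ψ : FreeCommWire X →* C} (hφ : ∀ a b, φ (a ⊚ b) = φ a ⊚ φ b)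
    (hψ : ∀ a b, ψ (a ⊚ b) = ψ a ⊚ ψ b) (h : ∀ x, φ (of x) = ψ (of x)) : φ = ψ := by
  ext a
  induction a using induction_mon with
  | h1 => rw [map_one, map_one]
  | hi a ha => rw [map_inv, map_inv, ha]
  | hmul a b ha hb => rw [map_mul, map_mul, ha, hb]
  | hm m => exact hom_mon_unique hφ hψ h m

/-- The skew brace of fractions of `F / N'` is the free commutative skew brace on `X`. -/
theorem isFreeCommSkewBrace_fractions (X : Type u) :
    IsFreeCommSkewBrace.{u, u, w} fun x : X => Fractions.frac (FreeCommWire.of x) 1 := by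
  intro C _ f
  refine ⟨Fractions.lift (eval f) (eval_circ f),
    ⟨Fractions.isSkewBraceHom_lift _ _, fun x => ?_⟩, ?_⟩
  · have h := Fractions.lift_frac_circ (eval f) (eval_circ f) (of x) 1
    rwa [map_one, CommWire.circ_one, eval_of] at h
  · rintro ψ ⟨hψ, hx⟩
    let χ : FreeCommWire X →* C := MonoidHom.mk' (fun a => ψ (Fractions.frac a 1)) fun a b => by
      rw [Fractions.frac_mul_one, hψ.map_mul]
    have hχ : χ = eval f := by
      refine hom_unique (fun a b => ?_) (eval_circ f) fun x => (hx x).trans (eval_of f x).symm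
      change ψ _ = ψ _ ⊚ ψ _
      rw [Fractions.frac_circ_one, hψ.map_circ]
    funext q
    obtain ⟨a, b, rfl⟩ := Fractions.exists_frac q
    rw [Fractions.lift_frac, CommSkewBrace.eq_circ_circInv_iff, ← hχ]
    change _ ⊚ ψ _ = ψ _
    rw [← hψ.map_circ, Fractions.frac_circ_denom]

end FreeCommWire

/-! ### The Magnus representation of `F / N'` -/

namespace PolyGroup

variable {X : Type u}

instance : CommGroup (PolyGroup X ⧸ N X) where
  mul_comm a b := by
    obtain ⟨x, rfl⟩ := QuotientGroup.mk_surjective a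
    obtain ⟨y, rfl⟩ := QuotientGroup.mk_surjective b
    have h := mk_map_eq (MulAut.conj x).toMonoidHom (FreeCommWire.conj_mod x) y
    change (QuotientGroup.mk (x * y * x⁻¹) : PolyGroup X ⧸ N X) = _ at h
    rwa [QuotientGroup.mk_mul, QuotientGroup.mk_mul, QuotientGroup.mk_inv,
      mul_inv_eq_iff_eq_mul] at h

variable (X) in
/-- The free abelian group on `X`. -/
abbrev Exponent : Type u := Multiplicative (X →₀ ℤ)

variable (X) in
/-- The free commutative monoid on `X`. -/
abbrev NatExponent : Type u := Multiplicative (X →₀ ℕ)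

variable (X) in
/-- The ring of polynomials in `X` over the group ring of the free abelian group on `X`. -/
abbrev MagnusRing : Type u := MonoidAlgebra ℤ (Exponent X × NatExponent X)

/-- The exponent vector of a monomial. -/
noncomputable def natExp (m : FreeCommSemigroup X) : NatExponent X :=
  .ofAdd (m.1.map fun x => Finsupp.single x 1).sum

theorem natExp_mul (m l : FreeCommSemigroup X) : natExp (m * l) = natExp m * natExp l := by
  change Multiplicative.ofAdd ((m.1 + l.1).map _).sum = _
  rw [Multiset.map_add, Multiset.sum_add]
  rfl

/-- A monomial can be recovered from its polynomial counterpart, which `pathHom` relies on. -/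
theorem toMultiset_natExp (m : FreeCommSemigroup X) :
    Finsupp.toMultiset (natExp m).toAdd = m.1 := by
  induction m using FreeCommSemigroup.induction_on with
  | of x => simp [natExp, FreeCommSemigroup.of]
  | of_mul x m ih =>
    rw [natExp_mul, toAdd_mul, map_add, ih]
    simp [natExp, FreeCommSemigroup.of]
    rfl

/-- The exponent vector of a monomial, as an element of the free abelian group. -/
noncomputable def intExp (m : FreeCommSemigroup X) : Exponent X :=
  .ofAdd (m.1.map fun x => Finsupp.single x 1).sum

theorem intExp_mul (m l : FreeCommSemigroup X) : intExp (m * l) = intExp m * intExp l := by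
  change Multiplicative.ofAdd ((m.1 + l.1).map _).sum = _
  rw [Multiset.map_add, Multiset.sum_add]
  rfl

/-- The canonical homomorphism from `F` to the free abelian group on `X`. -/
noncomputable def wordExp : PolyGroup X →* Exponent X := FreeGroup.lift intExp

@[simp]
theorem wordExp_mon (m : FreeCommSemigroup X) : wordExp (mon m) = intExp m :=
  FreeGroup.lift_apply_of

theorem N_le_ker_wordExp : N X ≤ wordExp.ker := by
  refine Subgroup.normalClosure_le_normal ?_
  rintro _ ⟨m, l, rfl⟩
  simp [MonoidHom.mem_ker, intExp_mul]

/-- The homomorphism from the free abelian group on `X` to `F / N`. -/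
noncomputable def ofExponent : Exponent X →* PolyGroup X ⧸ N X :=
  AddMonoidHom.toMultiplicativeLeft (Finsupp.liftAddHom fun x : X =>
    zmultiplesHom _ (Additive.ofMul (QuotientGroup.mk (mon (FreeCommSemigroup.of x)))))

/-- Modulo `N` every monomial is the product of its variables. Consequently the kernel of `wordExp`
lies in `N`, the converse of `N_le_ker_wordExp`. -/
theorem ofExponent_wordExp (w : PolyGroup X) : ofExponent (wordExp w) = QuotientGroup.mk w := by
  suffices h : ofExponent.comp wordExp = QuotientGroup.mk' (N X) from DFunLike.congr_fun h w
  refine FreeGroup.ext_hom _ _ fun m => ?_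
  have hof : ∀ x : X, ofExponent (intExp (FreeCommSemigroup.of x)) =
      QuotientGroup.mk (mon (FreeCommSemigroup.of x)) := fun x => by
    simp [ofExponent, intExp, FreeCommSemigroup.of]
  change ofExponent (wordExp (mon m)) = QuotientGroup.mk (mon m)
  rw [wordExp_mon]
  induction m using FreeCommSemigroup.induction_on with
  | of x => exact hof x
  | of_mul x m ih => rw [intExp_mul, map_mul, hof, ih, mk_mul_mon]

/-- The embedding of the free abelian group into the Magnus ring. -/
noncomputable def coeffUnit : Exponent X →* MagnusRing X :=
  (MonoidAlgebra.of ℤ _).comp (MonoidHom.inl _ _)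

/-- The embedding of the free commutative monoid into the Magnus ring. -/
noncomputable def polyMon : NatExponent X →* MagnusRing X :=
  (MonoidAlgebra.of ℤ _).comp (MonoidHom.inr _ _)

theorem coeffUnit_mul_polyMon (a : Exponent X) (t : NatExponent X) :
    coeffUnit a * polyMon t = MonoidAlgebra.single (a, t) 1 := by
  simp [coeffUnit, polyMon, MonoidAlgebra.single_mul_single]

theorem coeffUnit_inv_mul (a : Exponent X) (y : MagnusRing X) :
    coeffUnit a⁻¹ * (coeffUnit a * y) = y := by
  rw [← mul_assoc, ← map_mul, inv_mul_cancel, map_one, one_mul]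

theorem coeffUnit_mul_inv (a : Exponent X) (y : MagnusRing X) :
    coeffUnit a * (coeffUnit a⁻¹ * y) = y := by
  rw [← mul_assoc, ← map_mul, mul_inv_cancel, map_one, one_mul]

/-- The affine permutation `y ↦ a (y - 1) + t` of the Magnus ring given by a monomial. -/
noncomputable def affineMon (m : FreeCommSemigroup X) : Equiv.Perm (MagnusRing X) where
  toFun y := coeffUnit (intExp m) * (y - 1) + polyMon (natExp m)
  invFun y := coeffUnit (intExp m)⁻¹ * (y - polyMon (natExp m)) + 1
  left_inv y := by
    beta_reduce
    rw [add_sub_cancel_right, coeffUnit_inv_mul, sub_add_cancel]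
  right_inv y := by
    beta_reduce
    rw [add_sub_cancel_right, coeffUnit_mul_inv, sub_add_cancel]

/-- The action of `F` on the Magnus ring by affine permutations. -/
noncomputable def affine : PolyGroup X →* Equiv.Perm (MagnusRing X) := FreeGroup.lift affineMon

theorem affine_mon (m : FreeCommSemigroup X) (y : MagnusRing X) :
    affine (mon m) y = coeffUnit (intExp m) * (y - 1) + polyMon (natExp m) := by
  rw [affine, FreeGroup.lift_apply_of]
  rfl

/-- The linear part of the affine map depends only on the exponent of the word; the base point `1`
carries all other information. -/
theorem affine_apply (w : PolyGroup X) (y : MagnusRing X) :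
    affine w y = coeffUnit (wordExp w) * (y - 1) + affine w 1 := by
  induction w using FreeGroup.induction_on generalizing y with
  | C1 => simp
  | of m =>
    change affine (mon m) y = coeffUnit (wordExp (mon m)) * (y - 1) + affine (mon m) 1
    rw [affine_mon, affine_mon, wordExp_mon]
    ring
  | inv_of m _ =>
    change affine (mon m)⁻¹ y = coeffUnit (wordExp (mon m)⁻¹) * (y - 1) + affine (mon m)⁻¹ 1
    have h : ∀ z, affine (mon m)⁻¹ z =
        coeffUnit (intExp m)⁻¹ * (z - polyMon (natExp m)) + 1 := fun z => by
      rw [map_inv, affine, FreeGroup.lift_apply_of]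
      rfl
    rw [h, h, map_inv wordExp, wordExp_mon]
    ring
  | mul v w hv hw =>
    rw [map_mul, map_mul, map_mul, Equiv.Perm.mul_apply, Equiv.Perm.mul_apply, hv, hw y,
      hv (affine w 1)]
    ring

/-- Elements of `N` have exponent `1`, so they act by translations, and translations commute. -/
theorem commutator_N_le_ker_affine : N' X ≤ (affine (X := X)).ker := by
  refine Subgroup.commutator_le.2 fun a ha b hb => ?_
  have h : ∀ c ∈ N X, ∀ y, affine c y = y - 1 + affine c 1 := fun c hc y => by
    rw [affine_apply, show wordExp c = 1 from N_le_ker_wordExp hc, map_one, one_mul]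
  rw [MonoidHom.mem_ker, map_commutatorElement, commutatorElement_eq_one_iff_mul_comm]
  ext1 y
  rw [Equiv.Perm.mul_apply, Equiv.Perm.mul_apply, h a ha, h b hb y, h b hb (affine a y),
    h a ha y]
  ring

/-! ### Faithfulness -/

/-- A set-theoretic section of the homomorphism from `F` to the free abelian group. -/
noncomputable def sec (a : Exponent X) : PolyGroup X := (ofExponent a).out

theorem mk_sec (a : Exponent X) : (QuotientGroup.mk (sec a) : PolyGroup X ⧸ N X) = ofExponent a :=
  QuotientGroup.out_eq' _

theorem sec_mul_mem (a : Exponent X) (w : PolyGroup X) :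
    sec a * w * (sec (a * wordExp w))⁻¹ ∈ N X := by
  rw [← QuotientGroup.eq_one_iff, QuotientGroup.mk_mul, QuotientGroup.mk_mul,
    QuotientGroup.mk_inv, mk_sec, mk_sec, map_mul, ofExponent_wordExp, mul_inv_cancel]

/-- The class in the abelianization of `N` of the path labelled `w` that starts at `a`. -/
noncomputable def pathClass (a : Exponent X) (w : PolyGroup X) :
    Additive (Abelianization (N X)) :=
  .ofMul (Abelianization.of ⟨_, sec_mul_mem a w⟩)

/-- Concatenation of paths in the Cayley graph of `F / N`: the section values at the common vertex
cancel. -/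
theorem pathClass_mul (a : Exponent X) (v w : PolyGroup X) :
    pathClass a (v * w) = pathClass a v + pathClass (a * wordExp v) w := by
  rw [pathClass, pathClass, pathClass, ← ofMul_mul, ← map_mul]
  congr 2
  apply Subtype.ext
  simp only [Subgroup.coe_mul, map_mul, mul_assoc, inv_mul_cancel_left]

theorem pathClass_one (a : Exponent X) : pathClass a 1 = 0 := by
  have h := pathClass_mul a 1 1
  rwa [mul_one, map_one, mul_one, left_eq_add] at h

theorem mem_N'_of_pathClass_eq_zero {w : PolyGroup X} (hw : wordExp w = 1)
    (h : pathClass 1 w = 0) : w ∈ N' X := by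
  have h1 : (⟨_, sec_mul_mem 1 w⟩ : N X) ∈ commutator (N X) := by
    rw [← Abelianization.ker_of]
    exact h
  have h2 : sec 1 * w * (sec 1)⁻¹ ∈ N' X := by
    rw [N', ← Subgroup.map_subtype_commutator]
    exact ⟨_, h1, by simp [hw]⟩
  -- The representative `sec 1` need not be `1`, but normality of `N'` removes this conjugation.
  rw [mul_assoc, Subgroup.Normal.mem_comm_iff inferInstance, inv_mul_cancel_right] at h2
  exact h2

open Classical in
/-- The additive map that sends `a (t - 1)`, for a monomial `t`, to the class of the path
labelled `t` that starts at `a`. -/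
noncomputable def pathHom : MagnusRing X →+ Additive (Abelianization (N X)) :=
  (Finsupp.liftAddHom fun p : Exponent X × NatExponent X => zmultiplesHom _
    (if h : Finsupp.toMultiset p.2.toAdd ≠ 0 then pathClass p.1 (mon ⟨_, h⟩) else 0)).comp
    MonoidAlgebra.coeffAddEquiv.toAddMonoidHom

/-- The empty monomial is not in the free semigroup and has value `0`, so `a t` and `a (t - 1)` have
the same image. -/
theorem pathHom_coeffUnit (a : Exponent X) : pathHom (coeffUnit a) = 0 := by
  rw [← mul_one (coeffUnit a), ← map_one polyMon, coeffUnit_mul_polyMon]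
  simp [pathHom]

theorem pathHom_mon (a : Exponent X) (m : FreeCommSemigroup X) :
    pathHom (coeffUnit a * polyMon (natExp m)) = pathClass a (mon m) := by
  rw [coeffUnit_mul_polyMon]
  have h : Finsupp.toMultiset (natExp m).toAdd ≠ 0 := by
    rw [toMultiset_natExp]
    exact m.2
  have e : (⟨_, h⟩ : FreeCommSemigroup X) = m := Subtype.ext (toMultiset_natExp m)
  simp only [pathHom, AddMonoidHom.comp_apply, AddEquiv.coe_toAddMonoidHom,
    MonoidAlgebra.coeffAddEquiv_apply, MonoidAlgebra.coeff_single,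
    Finsupp.liftAddHom_apply_single, zmultiplesHom_apply, one_smul]
  rw [dif_pos h, e]

theorem affine_one (y : MagnusRing X) : affine 1 y = y := by
  rw [map_one affine, Equiv.Perm.one_apply]

theorem affine_mul_one (v w : PolyGroup X) :
    affine (v * w) 1 = coeffUnit (wordExp v) * (affine w 1 - 1) + affine v 1 := by
  rw [map_mul, Equiv.Perm.mul_apply, affine_apply]

/-- Both sides obey the same cocycle rule in `w` and agree on monomials. Hence the Magnus value
determines the path class. -/
theorem pathHom_affine (w : PolyGroup X) (a : Exponent X) :
    pathHom (coeffUnit a * (affine w 1 - 1)) = pathClass a w := by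
  have hmul : ∀ a (v w : PolyGroup X), pathHom (coeffUnit a * (affine (v * w) 1 - 1)) =
      pathHom (coeffUnit a * (affine v 1 - 1)) +
        pathHom (coeffUnit (a * wordExp v) * (affine w 1 - 1)) := fun a v w => by
    rw [affine_mul_one, ← map_add, map_mul coeffUnit]
    congr 1
    ring
  induction w using FreeGroup.induction_on generalizing a with
  | C1 => simp [pathClass_one]
  | of m =>
    change pathHom (coeffUnit a * (affine (mon m) 1 - 1)) = pathClass a (mon m)
    rw [affine_mon, sub_self, mul_zero, zero_add, mul_sub, map_sub, mul_one, pathHom_mon,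
      pathHom_coeffUnit, sub_zero]
  | inv_of m ih =>
    -- The cocycle rule for `m⁻¹ * m = 1`, whose second summand is the known value for `m` at a
    -- shifted starting point.
    have h₁ := hmul a (mon m)⁻¹ (mon m)
    have h₂ := pathClass_mul a (mon m)⁻¹ (mon m)
    rw [inv_mul_cancel, ih] at h₁
    rw [inv_mul_cancel, pathClass_one] at h₂
    rw [affine_one, sub_self, mul_zero, map_zero, h₂] at h₁
    exact (add_right_cancel h₁).symm
  | mul v w hv hw => rw [hmul, hv, hw, pathClass_mul]

theorem mem_N'_of_affine_eq {w : PolyGroup X} (hw : wordExp w = 1) (h : affine w 1 = 1) :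
    w ∈ N' X := by
  refine mem_N'_of_pathClass_eq_zero hw ?_
  rw [← pathHom_affine, h, sub_self, mul_zero, map_zero]

/-- The substitution of the polynomial variables by the generators of the free abelian group. -/
noncomputable def specialize : MagnusRing X →+* MonoidAlgebra ℤ (Exponent X) :=
  MonoidAlgebra.mapDomainRingHom ℤ ((MonoidHom.id (Exponent X)).coprod
    (AddMonoidHom.toMultiplicative (Finsupp.mapRange.addMonoidHom (Nat.castAddMonoidHom ℤ))))

theorem specialize_coeffUnit (a : Exponent X) :
    specialize (coeffUnit a) = MonoidAlgebra.of ℤ _ a := by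
  simp [specialize, coeffUnit]

theorem specialize_polyMon (m : FreeCommSemigroup X) :
    specialize (polyMon (natExp m)) = MonoidAlgebra.of ℤ _ (intExp m) := by
  induction m using FreeCommSemigroup.induction_on with
  | of x => simp [specialize, polyMon, natExp, intExp, FreeCommSemigroup.of]
  | of_mul x m ih =>
    rw [natExp_mul, intExp_mul, map_mul, map_mul, map_mul, ih]
    congr 1
    simp [specialize, polyMon, natExp, intExp, FreeCommSemigroup.of]

/-- For `t = a` the map `y ↦ a (y - 1) + t` becomes `y ↦ a y`, so the orbit of `1` consists of group
elements. -/
theorem specialize_affine (w : PolyGroup X) :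
    specialize (affine w 1) = MonoidAlgebra.of ℤ _ (wordExp w) := by
  induction w using FreeGroup.induction_on with
  | C1 => rw [affine_one, map_one specialize, map_one wordExp, map_one]
  | of m =>
    change specialize (affine (mon m) 1) = MonoidAlgebra.of ℤ _ (wordExp (mon m))
    rw [affine_mon, sub_self, mul_zero, zero_add, specialize_polyMon, wordExp_mon]
  | inv_of m ih =>
    have h := congrArg specialize (affine_mul_one (mon m)⁻¹ (mon m))
    rw [inv_mul_cancel, affine_one, map_add, map_mul, map_sub, map_one specialize,
      specialize_coeffUnit, ih, mul_sub, ← map_mul, ← map_mul, inv_mul_cancel, map_one wordExp,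
      map_one, mul_one] at h
    linear_combination -h
  | mul v w hv hw =>
    rw [affine_mul_one, map_add, map_mul, map_sub, map_one specialize, hv, hw, specialize_coeffUnit, mul_sub,
      mul_one, sub_add_cancel, ← map_mul, ← map_mul]

end PolyGroup

/-! ### Multiplicativity and injectivity of the Magnus representation; cancellation -/

namespace FreeCommWire

open PolyGroup

variable {X : Type u}

theorem commutator_N_le_ker_wordExp : N' X ≤ (wordExp (X := X)).ker :=
  (Subgroup.commutator_le_left _ _).trans N_le_ker_wordExp

/-- The canonical homomorphism from `F / N'` to the free abelian group on `X`. -/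
noncomputable def exponent : FreeCommWire X →* Exponent X := lift wordExp commutator_N_le_ker_wordExp

/-- The Magnus representation: the orbit map of `1` under the affine action on the Magnus
ring. -/
noncomputable def magnus (a : FreeCommWire X) : MagnusRing X := lift affine commutator_N_le_ker_affine a 1

theorem magnus_mk (w : PolyGroup X) : magnus (mk w) = affine w 1 := rfl

theorem exponent_mk (w : PolyGroup X) : exponent (mk w) = wordExp w := rfl

theorem magnus_one : magnus (1 : FreeCommWire X) = 1 := by
  rw [← map_one mk, magnus_mk, affine_one]

theorem magnus_mul (a b : FreeCommWire X) :
    magnus (a * b) = coeffUnit (exponent a) * (magnus b - 1) + magnus a := by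
  obtain ⟨v, rfl⟩ := mk_surjective a
  obtain ⟨w, rfl⟩ := mk_surjective b
  rw [← map_mul, magnus_mk, affine_mul_one, magnus_mk, magnus_mk, exponent_mk]

theorem magnus_inv (a : FreeCommWire X) :
    magnus a⁻¹ = coeffUnit (exponent a)⁻¹ * (1 - magnus a) + 1 := by
  have h := magnus_mul a⁻¹ a
  rw [inv_mul_cancel, magnus_one, map_inv] at h
  linear_combination -h

theorem magnus_mon (m : FreeCommSemigroup X) : magnus (mk (mon m)) = polyMon (natExp m) := by
  rw [magnus_mk, affine_mon, sub_self, mul_zero, zero_add]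

theorem exponent_circ (a b : FreeCommWire X) : exponent (a ⊚ b) = exponent a * exponent b := by
  induction a using induction_mon with
  | h1 => rw [one_circ, map_one, one_mul]
  | hi a h => rw [inv_circ, map_mul, map_mul, map_inv, map_inv, h]; group
  | hmul a c ha hc => rw [mul_circ, map_mul, map_mul, map_inv, ha, hc, map_mul]; group
  | hm m =>
    induction b using induction_mon with
    | h1 => rw [circ_one, map_one, mul_one]
    | hi a h => rw [circ_inv, map_mul, map_mul, map_inv, map_inv, h]; group
    | hmul a c ha hc =>
      rw [circ_mul, map_mul, map_mul, map_inv, ha, hc, map_mul]; group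
    | hm l => rw [mon_circ_mon, exponent_mk, exponent_mk, exponent_mk, wordExp_mon, wordExp_mon,
        wordExp_mon, intExp_mul]

/-- In `a ⊚ c * c⁻¹ * b ⊚ c` the prefix `a ⊚ c * c⁻¹` has the exponent of `a`, so the cocycle rule
for `magnus (a * b)` reappears multiplied by `magnus c`. -/
theorem magnus_mul_circ (a b c : FreeCommWire X) (ha : magnus (a ⊚ c) = magnus a * magnus c)
    (hb : magnus (b ⊚ c) = magnus b * magnus c) :
    magnus ((a * b) ⊚ c) = magnus (a * b) * magnus c := by
  rw [mul_circ, magnus_mul, magnus_mul, magnus_inv, ha, hb, magnus_mul, map_mul exponent, map_inv,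
    exponent_circ, mul_inv_cancel_right, map_mul coeffUnit]
  have h := coeffUnit_mul_inv (exponent c) (1 - magnus c)
  linear_combination coeffUnit (exponent a) * h

theorem magnus_inv_circ (a c : FreeCommWire X) (ha : magnus (a ⊚ c) = magnus a * magnus c) :
    magnus (a⁻¹ ⊚ c) = magnus a⁻¹ * magnus c := by
  -- By distributivity the product is `(a⁻¹ * a) ⊚ c = c`, and the resulting equation is solved for
  -- `magnus (a⁻¹ ⊚ c)`.
  have h := magnus_mul (a⁻¹ ⊚ c * c⁻¹) (a ⊚ c)
  rw [← mul_circ, inv_mul_cancel, one_circ, magnus_mul, magnus_inv c, ha, map_mul exponent,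
    map_inv, exponent_circ, map_inv, mul_inv_cancel_right, map_mul coeffUnit] at h
  rw [magnus_inv a]
  have h' := coeffUnit_mul_inv (exponent c) (1 - magnus c)
  linear_combination - h - coeffUnit (exponent a)⁻¹ * h'

theorem magnus_circ (a b : FreeCommWire X) : magnus (a ⊚ b) = magnus a * magnus b := by
  induction a using induction_mon with
  | h1 => rw [one_circ, magnus_one, one_mul]
  | hi a h => exact magnus_inv_circ a b h
  | hmul a c ha hc => exact magnus_mul_circ a c b ha hc
  | hm m =>
    rw [circ_comm, mul_comm]
    induction b using induction_mon with
    | h1 => rw [one_circ, magnus_one, one_mul]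
    | hi a h => exact magnus_inv_circ a _ h
    | hmul a c ha hc => exact magnus_mul_circ a c _ ha hc
    | hm l => rw [mon_circ_mon, magnus_mon, magnus_mon, magnus_mon, natExp_mul, map_mul]

theorem specialize_magnus (a : FreeCommWire X) :
    specialize (magnus a) = MonoidAlgebra.of ℤ _ (exponent a) := by
  obtain ⟨w, rfl⟩ := mk_surjective a
  exact specialize_affine w

theorem magnus_ne_zero (a : FreeCommWire X) : magnus a ≠ 0 := by
  intro h
  have h' := specialize_magnus a
  rw [h, map_zero] at h'
  exact MonoidAlgebra.single_ne_zero.2 one_ne_zero h'.symm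

theorem magnus_injective : Function.Injective (magnus (X := X)) := by
  intro a b h
  have he : exponent a = exponent b := by
    -- Specialization recovers the exponent from the Magnus value, so the exponents need not be
    -- assumed equal.
    refine MonoidAlgebra.of_injective (R := ℤ) ?_
    rw [← specialize_magnus, ← specialize_magnus, h]
  have hab : magnus (a⁻¹ * b) = 1 := by
    rw [magnus_mul, magnus_inv, h, map_inv]
    ring
  have hexp : exponent (a⁻¹ * b) = 1 := by rw [map_mul, map_inv, he, inv_mul_cancel]
  obtain ⟨w, hw⟩ := mk_surjective (a⁻¹ * b)
  rw [← hw] at hab hexp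
  have h1 : mk w = 1 := (QuotientGroup.eq_one_iff w).2 (mem_N'_of_affine_eq hexp hab)
  rw [hw, inv_mul_eq_one] at h1
  exact h1

theorem circ_right_cancel {a b c : FreeCommWire X} (h : a ⊚ c = b ⊚ c) : a = b := by
  refine magnus_injective (mul_right_cancel₀ (magnus_ne_zero c) ?_)
  rw [← magnus_circ, ← magnus_circ, h]

theorem frac_eq_frac_iff {a b a₁ b₁ : FreeCommWire X} :
    Fractions.frac a b = Fractions.frac a₁ b₁ ↔ a ⊚ b₁ = b ⊚ a₁ := by
  rw [circ_comm b]
  refine ⟨fun h => ?_, fun h => Fractions.frac_eq 1 (by rw [h])⟩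
  obtain ⟨k, hk⟩ := Quotient.exact (s := CommWire.fracSetoid _) h
  exact circ_right_cancel hk

end FreeCommWire

theorem theorem3 (X : Type u) :
    -- `(F / N', ∘)` is cancellative
    (∀ a b c : FreeCommWire X, a ⊚ c = b ⊚ c → a = b) ∧
    -- the elements of the skew brace of fractions are the fractions `a / b`
    (∀ q : Fractions (FreeCommWire X), ∃ a b : FreeCommWire X, q = Fractions.frac a b) ∧
    -- equality of fractions
    (∀ a b a₁ b₁ : FreeCommWire X,
      Fractions.frac a b = Fractions.frac a₁ b₁ ↔ a ⊚ b₁ = b ⊚ a₁) ∧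
    -- the two operations
    (∀ a b a₁ b₁ : FreeCommWire X,
      Fractions.frac a b * Fractions.frac a₁ b₁ =
        Fractions.frac (a ⊚ b₁ * (b ⊚ b₁)⁻¹ * b ⊚ a₁) (b ⊚ b₁)) ∧
    (∀ a b a₁ b₁ : FreeCommWire X,
      Fractions.frac a b ⊚ Fractions.frac a₁ b₁ = Fractions.frac (a ⊚ a₁) (b ⊚ b₁)) ∧
    -- the skew brace of fractions is the free commutative skew brace on `X`
    IsFreeCommSkewBrace.{u, u, w} fun x : X => Fractions.frac (FreeCommWire.of x) 1 := by
  refine ⟨fun _ _ _ => FreeCommWire.circ_right_cancel, Fractions.exists_frac,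
    fun _ _ _ _ => FreeCommWire.frac_eq_frac_iff, fun a b a₁ b₁ => ?_, Fractions.frac_circ,
    FreeCommWire.isFreeCommSkewBrace_fractions X⟩
  rw [Fractions.frac_mul, CommWire.circ_comm b a₁]
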